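/- All polynomials have complex coefficients. A homogeneous polynomial $f$ is called $n$-decomposable if $f=F(g_1,\dots,g_n)$ for some polynomial $F$ in $n$ variables and some homogeneous polynomials $g_1,\dots,g_n$ of degree strictly smaller than $\deg f$ (so constants, including $0$, are $0$-decomposable, and a non-zero linear form is not $n$-decomposable for any $n$). For homogeneous polynomials $f_1,\dots,f_r\in\mathbb{C}[x_1,\dots,x_m]$, let $\nu(f_1,\dots,f_r)\in\mathbb{N}\cup\{\infty\}$ be the minimal $n$ such that some homogeneous linear combination $\alpha_1f_1+\cdots+\alpha_rf_r$, with $\alpha_1,\dots,\alpha_r\in\mathbb{C}$ not all zero, is $n$-decomposable, and $\infty$ if there is no such $n$. We say that $f_1,\dots,f_r$ form a regular sequence if their common zero locus in $\mathbb{C}^m$ has codimension $r$. Theorem. Given $d,r\in\mathbb{N}$, there exists $N\in\mathbb{N}$ with the following property: for every $m\in\mathbb{N}$ and all homogeneous polynomials $f_1,\dots,f_r\in\mathbb{C}[x_1,\dots,x_m]$ of degrees $\le d$ with $\nu(f_1,\dots,f_r)>N$, the polynomials $f_1,\dots,f_r$ form a regular sequence. -/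

import Mathlib

noncomputable section

namespace NuComplexity

/-- A polynomial over `ℂ` is homogeneous if it is homogeneous of some degree. -/
def IsHomog {m : ℕ} (f : MvPolynomial (Fin m) ℂ) : Prop :=
  ∃ e : ℕ, f.IsHomogeneous e

/-- `f` is `n`-decomposable: `f = F(g₁, …, gₙ)` for some polynomial `F` in `n` variables and
homogeneous polynomials `g₁, …, gₙ` of degree strictly smaller than that of `f`.
Constants (including `0`) are `0`-decomposable, and a nonzero linear form is not `n`-decomposable
for any `n`. -/
def IsDecomposable {m : ℕ} (n : ℕ) (f : MvPolynomial (Fin m) ℂ) : Prop :=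
  ∃ (g : Fin n → MvPolynomial (Fin m) ℂ) (F : MvPolynomial (Fin n) ℂ),
    (∀ j, IsHomog (g j) ∧ (g j).totalDegree < f.totalDegree) ∧ f = MvPolynomial.aeval g F

/-- The collection `f₁, …, f_r` is `n`-decomposable: some non-trivial homogeneous `ℂ`-linear
combination of the `fᵢ` is `n`-decomposable. -/
def IsJointlyDecomposable {m r : ℕ} (n : ℕ) (f : Fin r → MvPolynomial (Fin m) ℂ) : Prop :=
  ∃ α : Fin r → ℂ, α ≠ 0 ∧ IsHomog (∑ i, α i • f i) ∧ IsDecomposable n (∑ i, α i • f i)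

/-- The complexity `ν(f₁, …, f_r)`: the least `n` such that the collection is `n`-decomposable,
and `∞` if there is no such `n`. -/
def nu {m r : ℕ} (f : Fin r → MvPolynomial (Fin m) ℂ) : ℕ∞ :=
  ⨅ (n : ℕ) (_ : IsJointlyDecomposable n f), (n : ℕ∞)

/-- The common zero locus in `ℂᵐ` of `f₁, …, f_r`. -/
def commonZeros {m r : ℕ} (f : Fin r → MvPolynomial (Fin m) ℂ) : Set (Fin m → ℂ) :=
  {x | ∀ i, MvPolynomial.eval x (f i) = 0}

/-- The dimension of an algebraic subset `Z` of `ℂᵐ`: the Krull dimension of its coordinate ring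
`ℂ[x₁, …, x_m] / I(Z)` (it is `⊥` for the empty set). -/
def algDim {m : ℕ} (Z : Set (Fin m → ℂ)) : WithBot ℕ∞ :=
  ringKrullDim (MvPolynomial (Fin m) ℂ ⧸ MvPolynomial.vanishingIdeal ℂ Z)

/-- `Z ⊆ ℂᵐ` has codimension `c`, that is, `dim Z = m - c`. -/
def HasCodim {m : ℕ} (Z : Set (Fin m → ℂ)) (c : ℕ) : Prop :=
  algDim Z + (c : WithBot ℕ∞) = (m : WithBot ℕ∞)

/-- `f₁, …, f_r` is a regular sequence: the locus `f₁ = ⋯ = f_r = 0` in `ℂᵐ` has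
codimension `r`. -/
def IsRegularSeq {m r : ℕ} (f : Fin r → MvPolynomial (Fin m) ℂ) : Prop :=
  HasCodim (commonZeros f) r

end NuComplexity

end

/-! Restrict the `f i` to a generic linear image of an `r`-dimensional space, `X_l ↦ ∑ j, x_{j,l}
t_j`. The coefficients of the restrictions are forms in the `x_{j,l}`, and their number depends only
on `r` and the degrees. There are two cases.

If they are algebraically dependent, expand a minimal relation around a general point. In a suitable
degree `n` this puts a nontrivial combination of the degree `n` coefficients in an algebra generated
by boundedly many forms of smaller degree (`exists_linearCombination_mem_adjoin`). Setting `x_{j,l}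
= s_j X_l` turns every coefficient into a scalar multiple of some `f i`, so `ν` is bounded
(`exists_isJointlyDecomposable`).

If they are independent, no nonzero polynomial condition on `r` forms holds for all restrictions.
Some restriction thus has a nonzero Macaulay determinant and generates all monomials of some degree
(`exists_monomial_mem_span_restriction`). Then `f` and `m - r` linear forms cut out only the origin,
which forces codimension `r` (`isRegularSeq_of_monomial_mem_span_restriction`). -/

open MvPolynomial

/-! ### Homogeneous components of products and of polynomial expressions -/

section Components

variable {σ ι K : Type*} [Field K]

attribute [local instance] MvPolynomial.gradedAlgebra in
theorem homogeneousComponent_mul_of_isHomogeneous_left {a : MvPolynomial σ K} {k : ℕ}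
    (ha : a.IsHomogeneous k) (p : MvPolynomial σ K) (n : ℕ) :
    homogeneousComponent n (a * p) =
      if k ≤ n then a * homogeneousComponent (n - k) p else 0 := by
  have h (q : MvPolynomial σ K) (j : ℕ) :
      (DirectSum.decompose (homogeneousSubmodule σ K) q j : MvPolynomial σ K) =
        homogeneousComponent j q := decomposition.decompose'_apply q j
  rw [← h, ← h, DirectSum.coe_decompose_mul_of_left_mem (homogeneousSubmodule σ K) n ha]

theorem homogeneousComponent_mul (p q : MvPolynomial σ K) (n : ℕ) :
    homogeneousComponent n (p * q) = ∑ k ∈ Finset.range (n + 1),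
      homogeneousComponent k p * homogeneousComponent (n - k) q := by
  conv_lhs => rw [← sum_homogeneousComponent p, Finset.sum_mul, map_sum]
  simp_rw [homogeneousComponent_mul_of_isHomogeneous_left
    (homogeneousComponent_isHomogeneous _ p)]
  set N := max (p.totalDegree + 1) (n + 1)
  have h1 : ∑ k ∈ Finset.range (p.totalDegree + 1),
      (if k ≤ n then homogeneousComponent k p * homogeneousComponent (n - k) q else 0) =
      ∑ k ∈ Finset.range N,
      (if k ≤ n then homogeneousComponent k p * homogeneousComponent (n - k) q else 0) := by
    refine Finset.sum_subset (Finset.range_mono (le_max_left _ _)) fun k _ hk ↦ ?_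
    rw [homogeneousComponent_eq_zero k p (by simpa using hk)]
    simp
  rw [h1, ← Finset.sum_subset (Finset.range_mono (le_max_right (p.totalDegree + 1) (n + 1)))]
  · exact Finset.sum_congr rfl fun k hk ↦ if_pos (by simpa [Nat.lt_succ_iff] using hk)
  · intro k _ hk
    exact if_neg (by simpa using hk)

theorem coeff_zero_aeval (u : ι → MvPolynomial σ K) (P : MvPolynomial ι K) :
    coeff 0 (aeval u P) = eval (fun i ↦ coeff 0 (u i)) P := by
  simp_rw [← constantCoeff_eq]
  rw [aeval_def, hom_eval₂, eval, coe_eval₂Hom]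
  congr 1
  ext
  simp

/-- Modulo a subalgebra containing all lower components, the degree `n` component is a derivation
over the constant coefficient. -/
theorem homogeneousComponent_aeval_sub_mem [Fintype ι] (B : Subalgebra K (MvPolynomial σ K))
    {n : ℕ} (hn : 0 < n) (u : ι → MvPolynomial σ K)
    (hu : ∀ i, ∀ k < n, homogeneousComponent k (u i) ∈ B) (P : MvPolynomial ι K) :
    (∀ k < n, homogeneousComponent k (aeval u P) ∈ B) ∧
      homogeneousComponent n (aeval u P) -
        ∑ i, eval (fun i ↦ coeff 0 (u i)) (pderiv i P) • homogeneousComponent n (u i) ∈ B := by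
  classical
  induction P using MvPolynomial.induction_on with
  | C a =>
    have h (k : ℕ) : homogeneousComponent k (C a : MvPolynomial σ K) ∈ B := by
      rw [homogeneousComponent_of_mem (isHomogeneous_C σ a)]
      split_ifs
      · exact B.algebraMap_mem a
      · exact B.zero_mem
    simp [algHom_C, algebraMap_eq, h]
  | add p q hp hq =>
    refine ⟨fun k hk ↦ ?_, ?_⟩
    · rw [map_add, map_add]
      exact B.add_mem (hp.1 k hk) (hq.1 k hk)
    · convert! B.add_mem hp.2 hq.2 using 1
      simp only [map_add, add_smul, Finset.sum_add_distrib]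
      ring
  | mul_X p j hp =>
    rw [map_mul, aeval_X]
    refine ⟨fun k hk ↦ ?_, ?_⟩
    · rw [homogeneousComponent_mul]
      refine B.sum_mem fun l hl ↦ B.mul_mem (hp.1 l ?_) (hu j _ ?_)
      · simp at hl; omega
      · omega
    · obtain ⟨n, rfl⟩ := Nat.exists_eq_succ_of_ne_zero hn.ne'
      -- In degree `n`, only the two extreme terms of the product can leave `B`; they give the
      -- Leibniz rule.
      have hmid : ∑ k ∈ Finset.range n, homogeneousComponent (k + 1) (aeval u p) *
          homogeneousComponent (n.succ - (k + 1)) (u j) ∈ B := by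
        refine B.sum_mem fun l hl ↦ B.mul_mem (hp.1 _ ?_) (hu j _ ?_)
        · simp at hl; omega
        · omega
      convert! B.add_mem (B.smul_mem hp.2 (coeff 0 (u j))) hmid using 1
      rw [homogeneousComponent_mul, Finset.sum_range_succ, Finset.sum_range_succ']
      simp only [homogeneousComponent_zero, Nat.succ_eq_add_one, Nat.sub_self, Nat.sub_zero,
        coeff_zero_aeval, pderiv_mul, pderiv_X, map_add, map_mul, eval_X, add_smul,
        Finset.sum_add_distrib, smul_sub, Finset.smul_sum, smul_smul]
      have h2 : ∑ i, (eval (fun i ↦ coeff 0 (u i)) p *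
          eval (fun i ↦ coeff 0 (u i)) ((Pi.single i 1 : ι → MvPolynomial ι K) j)) •
            homogeneousComponent (n + 1) (u i) =
          eval (fun i ↦ coeff 0 (u i)) p • homogeneousComponent (n + 1) (u j) := by
        rw [Finset.sum_eq_single j]
        · simp
        · intro b _ hb
          simp [hb.symm]
        · simp
      rw [h2]
      simp only [smul_eq_C_mul, map_mul]
      simp only [mul_comm (C (eval _ (pderiv _ p)))]
      ring

end Components
-- Induction on forms
section Induction

variable {σ K : Type*} [Field K]

/-- Monomials are built one variable at a time, so the degree can be carried along in the motive. -/
theorem isHomogeneous_induction {M : ℕ → MvPolynomial σ K → Prop} (zero : ∀ n, M n 0)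
    (add : ∀ n p q, M n p → M n q → M n (p + q)) (smul : ∀ n (a : K) p, M n p → M n (a • p))
    (one : M 0 1) (mul_X : ∀ n p s, M n p → M (n + 1) (p * X s))
    {n : ℕ} {p : MvPolynomial σ K} (hp : p.IsHomogeneous n) : M n p := by
  have mul_X_pow (s : σ) (k n : ℕ) (p : MvPolynomial σ K) (h : M n p) :
      M (n + k) (p * X s ^ k) := by
    induction k with
    | zero => simpa using h
    | succ k ih =>
      rw [pow_succ, ← mul_assoc, ← add_assoc]
      exact mul_X _ _ _ ih
  have hmon (s : σ →₀ ℕ) : M s.degree (monomial s 1) := by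
    induction s using Finsupp.induction with
    | zero => simpa using one
    | single_add i k s _ _ ih =>
      have := mul_X_pow i k _ _ ih
      rw [X_pow_eq_monomial, monomial_mul, one_mul, add_comm s] at this
      rwa [map_add, Finsupp.degree_single, add_comm]
  rw [p.as_sum]
  refine Finset.sum_induction _ (M n) (add n) (zero n) fun s hs ↦ ?_
  rw [show n = s.degree from hp.degree_eq_sum_deg_support hs]
  simpa [smul_monomial] using smul _ (coeff s p) _ (hmon s)

end Induction

/-! ### Translation and leading forms -/

section Translate

variable {σ K : Type*} [Field K]

/-- The substitution `X ↦ X + x`. -/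
noncomputable def translateHom (x : σ → K) : MvPolynomial σ K →ₐ[K] MvPolynomial σ K :=
  aeval fun s ↦ X s + C (x s)

theorem coeff_zero_translateHom (x : σ → K) (p : MvPolynomial σ K) :
    coeff 0 (translateHom x p) = eval x p := by
  rw [translateHom, coeff_zero_aeval]
  simp

/-- Translation by `x` does not change `p`, a form of degree `n`, in degrees at least `n`. -/
def IsTranslateTop (x : σ → K) (n : ℕ) (p : MvPolynomial σ K) : Prop :=
  (∀ k, n < k → homogeneousComponent k (translateHom x p) = 0) ∧
    homogeneousComponent n (translateHom x p) = p

theorem IsTranslateTop.mul {x : σ → K} {m n : ℕ} {p q : MvPolynomial σ K}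
    (hp : IsTranslateTop x m p) (hq : IsTranslateTop x n q) : IsTranslateTop x (m + n) (p * q) := by
  constructor
  · intro k hk
    rw [map_mul, homogeneousComponent_mul]
    refine Finset.sum_eq_zero fun l _ ↦ ?_
    rcases lt_or_ge m l with h | h
    · rw [hp.1 l h, zero_mul]
    · rw [hq.1 (k - l) (by omega), mul_zero]
  · rw [map_mul, homogeneousComponent_mul, Finset.sum_eq_single m]
    · rw [hp.2, Nat.add_sub_cancel_left, hq.2]
    · intro l hl hlm
      rcases lt_or_gt_of_ne hlm with h | h
      · rw [hq.1 (m + n - l) (by omega), mul_zero]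
      · rw [hp.1 l h, zero_mul]
    · intro h
      simp at h

theorem IsTranslateTop.one (x : σ → K) : IsTranslateTop x 0 1 := by
  constructor
  · intro k hk
    rw [map_one, homogeneousComponent_of_mem (isHomogeneous_one σ K), if_neg hk.ne']
  · rw [map_one, homogeneousComponent_of_mem (isHomogeneous_one σ K), if_pos rfl]

theorem IsTranslateTop.X (x : σ → K) (s : σ) : IsTranslateTop x 1 (X s) := by
  constructor
  · intro k hk
    rw [translateHom, aeval_X, map_add, homogeneousComponent_of_mem (isHomogeneous_X K s),
      homogeneousComponent_of_mem (isHomogeneous_C σ (x s)), if_neg (by omega), if_neg (by omega),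
      add_zero]
  · rw [translateHom, aeval_X, map_add, homogeneousComponent_of_mem (isHomogeneous_X K s),
      homogeneousComponent_of_mem (isHomogeneous_C σ (x s)), if_pos rfl, if_neg (by omega),
      add_zero]

theorem isTranslateTop_of_isHomogeneous (x : σ → K) {p : MvPolynomial σ K} {n : ℕ}
    (hp : p.IsHomogeneous n) : IsTranslateTop x n p := by
  refine isHomogeneous_induction (fun n ↦ ⟨by simp, by simp⟩) ?_ ?_ (IsTranslateTop.one x)
    (fun n p s hp ↦ hp.mul (IsTranslateTop.X x s)) hp
  · rintro n p q ⟨hp, hp'⟩ ⟨hq, hq'⟩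
    exact ⟨fun k hk ↦ by rw [map_add, map_add, hp k hk, hq k hk, add_zero],
      by rw [map_add, map_add, hp', hq']⟩
  · rintro n a p ⟨hp, hp'⟩
    exact ⟨fun k hk ↦ by rw [map_smul, map_smul, hp k hk, smul_zero],
      by rw [map_smul, map_smul, hp']⟩

end Translate

/-! ### Algebraic relations between forms -/

section Relations

variable {σ ι K : Type*} [Field K]

theorem totalDegree_pderiv_lt {P : MvPolynomial ι K} {i : ι} (h : pderiv i P ≠ 0) :
    (pderiv i P).totalDegree < P.totalDegree := by
  obtain ⟨s, hs, hdeg⟩ := Finset.exists_mem_eq_sup (pderiv i P).support (by simpa using h)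
    fun s ↦ s.degree
  rw [mem_support_iff, coeff_pderiv] at hs
  have := le_totalDegree (mem_support_iff.2 (left_ne_zero_of_mul hs))
  have h2 : (pderiv i P).totalDegree = s.degree := hdeg
  change (s + Finsupp.single i 1).degree ≤ _ at this
  rw [map_add, Finsupp.degree_single] at this
  omega

theorem exists_eq_C_of_pderiv_eq_zero [CharZero K] {P : MvPolynomial ι K} (h : ∀ i, pderiv i P = 0) :
    ∃ a, P = C a := by
  classical
  refine ⟨coeff 0 P, ?_⟩
  ext s
  rw [coeff_C]
  split_ifs with hs
  · rw [hs]
  · obtain ⟨i, hi⟩ := Finsupp.ne_iff.1 (Ne.symm hs)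
    have := coeff_pderiv (i := i) P (s - Finsupp.single i 1)
    rw [h i, coeff_zero, tsub_add_cancel_of_le (Finsupp.single_le_iff.2 (by
      simpa [Nat.one_le_iff_ne_zero] using hi))] at this
    rcases mul_eq_zero.1 this.symm with h | h
    · exact h
    · exfalso; norm_cast at h

/-- If forms of positive degree are algebraically dependent then a nontrivial linear combination
of those of some fixed degree `n` lies in the subalgebra generated by few forms of smaller
degree. -/
theorem exists_linearCombination_mem_adjoin [CharZero K] [Fintype ι] (c : ι → MvPolynomial σ K) (e : ι → ℕ)
    (hc : ∀ i, (c i).IsHomogeneous (e i)) (he : ∀ i, 0 < e i) (h : ¬ AlgebraicIndependent K c) :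
    ∃ (i₀ : ι) (β : ι → K) (g : ι × Fin (e i₀) → MvPolynomial σ K),
      β i₀ ≠ 0 ∧ (∀ i, β i ≠ 0 → e i = e i₀) ∧ (∀ p, (g p).IsHomogeneous p.2) ∧
      ∑ i, β i • c i ∈ Algebra.adjoin K (Set.range g) := by
  classical
  have hex : ∃ n, ∃ P : MvPolynomial ι K, P ≠ 0 ∧ aeval c P = 0 ∧ P.totalDegree = n := by
    by_contra! hne
    refine h (algebraicIndependent_iff.2 fun P hP ↦ ?_)
    by_contra hP0
    exact hne _ P hP0 hP rfl
  obtain ⟨P, hP0, hP, hPn⟩ := Nat.find_spec hex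
  have hmin : ∀ Q : MvPolynomial ι K, Q ≠ 0 → aeval c Q = 0 → P.totalDegree ≤ Q.totalDegree :=
    fun Q hQ0 hQ ↦ hPn ▸ Nat.find_min' hex ⟨Q, hQ0, hQ, rfl⟩
  -- A nonzero partial derivative of `P` has smaller total degree, so by minimality it is not a
  -- relation. In characteristic zero not all partials vanish, so `T` is nonempty.
  set T : Finset ι := Finset.univ.filter fun i ↦ aeval c (pderiv i P) ≠ 0 with hT
  have hmem (i : ι) : i ∈ T ↔ aeval c (pderiv i P) ≠ 0 := by
    rw [hT, Finset.mem_filter, and_iff_right (Finset.mem_univ i)]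
  have hTne : T.Nonempty := by
    by_contra hne
    have hzero : ∀ i, pderiv i P = 0 := fun i ↦ by
      by_contra hi
      have : aeval c (pderiv i P) = 0 := by
        by_contra h0
        exact hne ⟨i, (hmem i).2 h0⟩
      exact (totalDegree_pderiv_lt hi).not_ge (hmin _ hi this)
    obtain ⟨a, rfl⟩ := exists_eq_C_of_pderiv_eq_zero hzero
    simp only [algHom_C, algebraMap_eq, C_eq_zero] at hP
    exact hP0 (by rw [hP, C_0])
  -- Maximality of `e i₀` removes the terms of higher degree, whose degree `e i₀` components after
  -- translation are uncontrolled.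
  obtain ⟨i₀, hi₀, hmax⟩ := T.exists_max_image e hTne
  obtain ⟨x, hx⟩ : ∃ x : σ → K, eval x (aeval c (pderiv i₀ P)) ≠ 0 := by
    by_contra! hall
    exact (hmem i₀).1 hi₀ (MvPolynomial.funext fun x ↦ by rw [hall x, map_zero])
  set u : ι → MvPolynomial σ K := fun i ↦ translateHom x (c i) with hu
  set g : ι × Fin (e i₀) → MvPolynomial σ K := fun p ↦ homogeneousComponent p.2 (u p.1)
  have heval (Q : MvPolynomial ι K) : eval (fun i ↦ coeff 0 (u i)) Q = eval x (aeval c Q) := by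
    rw [← coeff_zero_translateHom x, ← AlgHom.comp_apply, comp_aeval, coeff_zero_aeval]
  -- The degree `e i₀` part of the translated relation: forms of lower degree contribute zero, and
  -- those of degree `e i₀` reappear unchanged.
  have key := (homogeneousComponent_aeval_sub_mem (Algebra.adjoin K (Set.range g)) (he i₀) u
    (fun i k hk ↦ Algebra.subset_adjoin ⟨(i, ⟨k, hk⟩), rfl⟩) P).2
  have hzero : aeval u P = 0 := by
    have : u = fun i ↦ translateHom x (c i) := rfl
    rw [this, ← comp_aeval, AlgHom.comp_apply, hP, map_zero]
  rw [hzero, map_zero, zero_sub, neg_mem_iff] at key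
  refine ⟨i₀, fun i ↦ if e i = e i₀ then eval x (aeval c (pderiv i P)) else 0, g, by simpa using hx,
    fun i hi ↦ ?_, fun p ↦ homogeneousComponent_isHomogeneous _ _, ?_⟩
  · by_contra hne
    simp [hne] at hi
  · convert key using 1
    refine Finset.sum_congr rfl fun i _ ↦ ?_
    rw [heval]
    dsimp only
    have htop := isTranslateTop_of_isHomogeneous x (hc i)
    split_ifs with hei
    · rw [hu, ← hei, htop.2]
    · rw [zero_smul]
      rcases lt_or_gt_of_ne hei with hlt | hgt
      · rw [hu, htop.1 _ hlt, smul_zero]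
      · have : aeval c (pderiv i P) = 0 := by
          by_contra h0
          exact hgt.not_ge (hmax i ((hmem i).2 h0))
        rw [this, map_zero, zero_smul]

end Relations

/-! ### Restriction to a generic linear subspace -/

section Restriction

variable {κ τ K : Type*} [Fintype κ] [Field K]

/-- The substitution `X_l ↦ ∑ j, x_{j,l} t_j` with indeterminate coefficients `x_{j,l}`. -/
noncomputable def genericRestriction :
    MvPolynomial τ K →ₐ[K] MvPolynomial κ (MvPolynomial (κ × τ) K) :=
  aeval fun l ↦ ∑ j, C (X (j, l)) * X j

/-- The substitution `X_l ↦ ∑ j, x_{j,l} t_j`. -/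
noncomputable def restriction (x : κ × τ → K) : MvPolynomial τ K →ₐ[K] MvPolynomial κ K :=
  aeval fun l ↦ ∑ j, C (x (j, l)) * X j

theorem map_genericRestriction (x : κ × τ → K) (p : MvPolynomial τ K) :
    map (eval x) (genericRestriction p : MvPolynomial κ _) = restriction x p := by
  induction p using MvPolynomial.induction_on with
  | C a => simp [genericRestriction, restriction, MvPolynomial.algebraMap_apply]
  | add p q hp hq => simp [hp, hq]
  | mul_X p l hp =>
    have h : map (eval x) (genericRestriction (X l : MvPolynomial τ K) : MvPolynomial κ _) =
        restriction x (X l) := by simp [genericRestriction, restriction]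
    rw [map_mul, map_mul, map_mul, hp, h]

theorem isHomogeneous_genericRestriction {p : MvPolynomial τ K} {n : ℕ} (hp : p.IsHomogeneous n) :
    (genericRestriction p : MvPolynomial κ _).IsHomogeneous n := by
  have := hp.aeval (R := K) (fun l : τ ↦ ∑ j : κ, C (X (j, l) : MvPolynomial (κ × τ) K) * X j)
    (n := 1) fun l ↦ IsHomogeneous.sum _ _ _ fun j _ ↦ isHomogeneous_C_mul_X _ _
  rwa [one_mul] at this

theorem isHomogeneous_restriction (x : κ × τ → K) {p : MvPolynomial τ K} {n : ℕ}
    (hp : p.IsHomogeneous n) : (restriction x p).IsHomogeneous n := by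
  rw [← map_genericRestriction]
  exact (isHomogeneous_genericRestriction hp).map _

theorem isHomogeneous_coeff_genericRestriction {p : MvPolynomial τ K} {n : ℕ}
    (hp : p.IsHomogeneous n) (μ : κ →₀ ℕ) :
    (coeff μ (genericRestriction p : MvPolynomial κ _)).IsHomogeneous n := by
  classical
  revert μ
  refine isHomogeneous_induction
    (M := fun n p ↦ ∀ μ, (coeff μ (genericRestriction p : MvPolynomial κ _)).IsHomogeneous n)
    ?_ ?_ ?_ ?_ ?_ hp
  · intro n μ
    simpa using isHomogeneous_zero _ _ n
  · intro n p q hp hq μ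
    simpa using (hp μ).add (hq μ)
  · intro n a p hp μ
    rw [map_smul, coeff_smul, smul_eq_C_mul]
    exact (hp μ).C_mul a
  · intro μ
    rw [map_one, coeff_one]
    split_ifs
    · exact isHomogeneous_one _ _
    · exact isHomogeneous_zero _ _ 0
  · intro n p l hp μ
    have : (genericRestriction (X l : MvPolynomial τ K) : MvPolynomial κ _) =
        ∑ j, C (X (j, l)) * X j := by simp [genericRestriction]
    rw [map_mul, this, Finset.mul_sum, coeff_sum]
    refine IsHomogeneous.sum _ _ _ fun j _ ↦ ?_
    rw [mul_left_comm, coeff_C_mul, coeff_mul_X', add_comm]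
    split_ifs
    · exact (isHomogeneous_X K _).mul (hp _)
    · rw [mul_zero]
      exact isHomogeneous_zero _ _ _

/-- The substitution `x_{j,l} ↦ s_j X_l`. -/
noncomputable def diagonalSubst (s : κ → K) : MvPolynomial (κ × τ) K →ₐ[K] MvPolynomial τ K :=
  aeval fun p ↦ C (s p.1) * X p.2

/-- Each `X_l` becomes `(∑ j, s_j t_j) X_l`, and a form of degree `n` picks up the `n`-th power of
the common factor. -/
theorem map_diagonalSubst_genericRestriction (s : κ → K) {p : MvPolynomial τ K} {n : ℕ}
    (hp : p.IsHomogeneous n) :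
    map (diagonalSubst s).toRingHom (genericRestriction p : MvPolynomial κ _) =
      (∑ j, (C (s j) : MvPolynomial τ K) • X j) ^ n * C p := by
  refine isHomogeneous_induction (M := fun n p ↦
    map (diagonalSubst s).toRingHom (genericRestriction p : MvPolynomial κ _) =
      (∑ j, (C (s j) : MvPolynomial τ K) • X j) ^ n * C p) ?_ ?_ ?_ ?_ ?_ hp
  · simp
  · intro n p q hp hq
    simp only [map_add, hp, hq, mul_add]
  · intro n a p hp
    have : (genericRestriction (C a : MvPolynomial τ K) : MvPolynomial κ _) = C (C a) := by
      simp [genericRestriction, MvPolynomial.algebraMap_apply]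
    rw [smul_eq_C_mul, map_mul, map_mul, hp, this, map_C, C_mul]
    simp only [diagonalSubst, AlgHom.toRingHom_eq_coe, RingHom.coe_coe, algHom_C, algebraMap_eq]
    ring
  · simp
  · intro n p l hp
    have : map (diagonalSubst s).toRingHom
        (genericRestriction (X l : MvPolynomial τ K) : MvPolynomial κ _) =
        (∑ j, (C (s j) : MvPolynomial τ K) • X j) * C (X l) := by
      simp only [genericRestriction, diagonalSubst, aeval_X, map_sum, map_mul, map_C, map_X,
        AlgHom.toRingHom_eq_coe, RingHom.coe_coe, smul_eq_C_mul, Finset.sum_mul]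
      exact Finset.sum_congr rfl fun j _ ↦ by ring
    rw [map_mul, map_mul, hp, this, C_mul]
    ring

theorem diagonalSubst_coeff_genericRestriction (s : κ → K) {p : MvPolynomial τ K} {n : ℕ}
    (hp : p.IsHomogeneous n) {μ : κ →₀ ℕ} (hμ : μ.degree = n) :
    diagonalSubst s (coeff μ (genericRestriction p : MvPolynomial κ _)) =
      ((μ.multinomial : K) * μ.prod fun j k ↦ s j ^ k) • p := by
  have h := congrArg (coeff μ) (map_diagonalSubst_genericRestriction s hp)
  rw [coeff_map, mul_comm, coeff_C_mul, coeff_linearCombination_X_pow_of_fintype, if_pos (show μ.sum (fun _ k ↦ k) = n from hμ)] at h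
  simp only [AlgHom.toRingHom_eq_coe, RingHom.coe_coe] at h
  rw [h, mul_comm, smul_eq_C_mul, C_mul, Finsupp.prod, Finsupp.prod, map_prod]
  simp

end Restriction

/-! ### Dependent coefficients bound the complexity -/

section Complexity

/-- The exponents of the monomials of degree `n` in `r` variables. -/
abbrev Exponent (r n : ℕ) : Type :=
  {μ : Fin r →₀ ℕ // μ ∈ Finset.finsuppAntidiag (Finset.univ : Finset (Fin r)) n}

theorem Exponent.degree_eq {r n : ℕ} (μ : Exponent r n) : μ.1.degree = n := by
  rw [Finsupp.degree_eq_sum]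
  exact (Finset.mem_finsuppAntidiag.1 μ.2).1

theorem mem_finsuppAntidiag_of_degree_eq {r n : ℕ} {μ : Fin r →₀ ℕ} (h : μ.degree = n) :
    μ ∈ Finset.finsuppAntidiag (Finset.univ : Finset (Fin r)) n :=
  Finset.mem_finsuppAntidiag.2 ⟨by rw [← h, Finsupp.degree_eq_sum], Finset.subset_univ _⟩

/-- The coefficients of the restrictions of `f` to a generic linear subspace of dimension `r`. -/
noncomputable def genericCoeff {m r : ℕ} (f : Fin r → MvPolynomial (Fin m) ℂ) (e : Fin r → ℕ) :
    (Σ i : Fin r, Exponent r (e i)) → MvPolynomial (Fin r × Fin m) ℂ :=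
  fun p ↦ coeff p.2.1 (genericRestriction (f p.1))

theorem exists_isJointlyDecomposable {m r : ℕ} (f : Fin r → MvPolynomial (Fin m) ℂ)
    (e : Fin r → ℕ) (hf : ∀ i, (f i).IsHomogeneous (e i)) (he : ∀ i, 0 < e i)
    (h : ¬ AlgebraicIndependent ℂ (genericCoeff f e)) :
    ∃ i, ∃ n ≤ Fintype.card (Σ i : Fin r, Exponent r (e i)) * e i,
      NuComplexity.IsJointlyDecomposable n f := by
  obtain ⟨⟨i, μ⟩, β, g, hβ, hdeg, hg, hmem⟩ := exists_linearCombination_mem_adjoin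
    (genericCoeff f e) (fun p ↦ e p.1)
    (fun p ↦ isHomogeneous_coeff_genericRestriction (hf p.1) p.2.1) (fun p ↦ he p.1) h
  dsimp only at g hdeg hg
  -- After the diagonal substitution the coefficient of `f i` is `Q` evaluated at `s`. Since
  -- multinomials are nonzero in `ℂ`, `Q ≠ 0` and `s` can be chosen to keep `f i` in the
  -- combination.
  set Q : MvPolynomial (Fin r) ℂ :=
    ∑ ν : Exponent r (e i), monomial ν.1 (β ⟨i, ν⟩ * (ν.1.multinomial : ℂ)) with hQ
  have hmult (ν : Fin r →₀ ℕ) : (ν.multinomial : ℂ) ≠ 0 := by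
    exact_mod_cast (Nat.multinomial_pos _ _).ne'
  have hQ0 : Q ≠ 0 := by
    intro h0
    have := congrArg (coeff μ.1) h0
    rw [hQ, coeff_sum, Finset.sum_eq_single μ] at this
    · simp [hβ, hmult] at this
    · intro ν _ hν
      rw [coeff_monomial, if_neg fun h ↦ hν (Subtype.ext h)]
    · simp
  obtain ⟨s, hs⟩ : ∃ s, eval s Q ≠ 0 := by
    by_contra! hall
    exact hQ0 (MvPolynomial.funext fun x ↦ by rw [hall x, map_zero])
  set α : Fin r → ℂ := fun k ↦ ∑ ν : Exponent r (e k),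
    β ⟨k, ν⟩ * ((ν.1.multinomial : ℂ) * ν.1.prod fun j k ↦ s j ^ k) with hα
  have hαi : α i ≠ 0 := by
    convert hs using 1
    simp only [hα, hQ, map_sum, eval_monomial]
    exact Finset.sum_congr rfl fun _ _ ↦ by ring
  have hαdeg (k : Fin r) (hk : α k ≠ 0) : e k = e i := by
    obtain ⟨ν, _, hν⟩ := Finset.exists_ne_zero_of_sum_ne_zero hk
    exact hdeg ⟨k, ν⟩ (left_ne_zero_of_mul hν)
  have hhom : (∑ k, α k • f k).IsHomogeneous (e i) := by
    refine IsHomogeneous.sum _ _ _ fun k _ ↦ ?_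
    by_cases hk : α k = 0
    · rw [hk, zero_smul]
      exact isHomogeneous_zero _ _ _
    · rw [smul_eq_C_mul, ← hαdeg k hk]
      exact (hf k).C_mul _
  have hsum : ∑ k, α k • f k = diagonalSubst s (∑ p, β p • genericCoeff f e p) := by
    rw [map_sum, Fintype.sum_sigma]
    refine Finset.sum_congr rfl fun k _ ↦ ?_
    rw [hα, Finset.sum_smul]
    refine Finset.sum_congr rfl fun ν _ ↦ ?_
    rw [map_smul, genericCoeff, diagonalSubst_coeff_genericRestriction s (hf k) ν.degree_eq,
      smul_smul]
  have hα0 : α ≠ 0 := fun h ↦ hαi (congrFun h i)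
  refine ⟨i, ?_⟩
  -- A zero combination has `totalDegree` `0`, so no generator could have smaller degree; it is
  -- `0`-decomposable instead.
  by_cases hzero : ∑ k, α k • f k = 0
  · exact ⟨0, Nat.zero_le _, α, hα0, ⟨e i, hhom⟩, Fin.elim0, 0, fun j ↦ j.elim0, by simp [hzero]⟩
  refine ⟨_, le_rfl, α, hα0, ⟨e i, hhom⟩, ?_⟩
  have hcard : Fintype.card ((Σ i : Fin r, Exponent r (e i)) × Fin (e i)) =
      Fintype.card (Σ i : Fin r, Exponent r (e i)) * e i := by
    rw [Fintype.card_prod, Fintype.card_fin]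
  set E := (Fintype.equivFinOfCardEq hcard).symm
  have hmem' : ∑ k, α k • f k ∈ Algebra.adjoin ℂ (Set.range fun j ↦ diagonalSubst s (g (E j))) := by
    have hr : (Set.range fun j ↦ diagonalSubst s (g (E j))) =
        diagonalSubst (τ := Fin m) s '' Set.range g := by
      rw [← Set.range_comp, ← E.surjective.range_comp]
      rfl
    rw [hr, ← AlgHom.map_adjoin, hsum]
    exact ⟨_, hmem, rfl⟩
  rw [Algebra.adjoin_range_eq_range_aeval] at hmem'
  obtain ⟨F, hF⟩ := hmem'
  refine ⟨_, F, fun j ↦ ?_, hF.symm⟩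
  have hj : (diagonalSubst s (g (E j)) : MvPolynomial (Fin m) ℂ).IsHomogeneous (E j).2 := by
    have := (hg (E j)).aeval (R := ℂ) (fun p : Fin r × Fin m ↦
      (C (s p.1) * X p.2 : MvPolynomial (Fin m) ℂ)) fun p ↦ isHomogeneous_C_mul_X _ _
    rwa [one_mul] at this
  refine ⟨⟨_, hj⟩, ?_⟩
  rw [hhom.totalDegree hzero]
  exact hj.totalDegree_le.trans_lt (E j).2.2

end Complexity

/-! ### Macaulay matrices and the independent case -/

section Macaulay

variable {r D : ℕ} {R S : Type*} [CommRing R] [CommRing S]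

/-- The square submatrix of the Macaulay matrix of `F` in degree `D` whose columns are the
coefficients of the forms `t^ν F_i / t_i^{e_i}`, where `i` is selected by `ν`. -/
noncomputable def macaulayMatrix (e : Fin r → ℕ) (sel : Exponent r D → Fin r)
    (F : Fin r → MvPolynomial (Fin r) R) : Matrix (Exponent r D) (Exponent r D) R :=
  Matrix.of fun ν ν' ↦ coeff ν.1
    (monomial (ν'.1 - Finsupp.single (sel ν') (e (sel ν'))) 1 * F (sel ν'))

theorem macaulayMatrix_map (e : Fin r → ℕ) (sel : Exponent r D → Fin r)
    (F : Fin r → MvPolynomial (Fin r) R) (φ : R →+* S) :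
    (macaulayMatrix e sel F).map φ = macaulayMatrix e sel fun i ↦ map φ (F i) := by
  ext ν ν'
  simp only [macaulayMatrix, Matrix.map_apply, Matrix.of_apply]
  rw [← coeff_map, map_mul, map_monomial, map_one]

theorem macaulayMatrix_X_pow (e : Fin r → ℕ) (sel : Exponent r D → Fin r)
    (hsel : ∀ ν, e (sel ν) ≤ ν.1 (sel ν)) :
    macaulayMatrix e sel (fun i ↦ (X i ^ e i : MvPolynomial (Fin r) R)) = 1 := by
  ext ν ν'
  simp only [macaulayMatrix, Matrix.of_apply]
  rw [X_pow_eq_monomial, monomial_mul, tsub_add_cancel_of_le (Finsupp.single_le_iff.2 (hsel ν')),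
    coeff_monomial, Matrix.one_apply, one_mul]
  simp only [Subtype.ext_iff, eq_comm]

/-- The columns represent elements of the ideal, so inverting the matrix writes each monomial of
degree `D` as a combination of them. -/
theorem monomial_mem_span_of_macaulayMatrix_det_ne_zero {K : Type*} [Field K] (e : Fin r → ℕ)
    (sel : Exponent r D → Fin r) (hsel : ∀ ν, e (sel ν) ≤ ν.1 (sel ν))
    {F : Fin r → MvPolynomial (Fin r) K} (hF : ∀ i, (F i).IsHomogeneous (e i))
    (hdet : (macaulayMatrix e sel F).det ≠ 0) (ν : Exponent r D) :
    monomial ν.1 (1 : K) ∈ Ideal.span (Set.range F) := by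
  classical
  set M := macaulayMatrix e sel F with hM
  set w := M⁻¹.mulVec (Pi.single ν 1) with hw
  have hMw : M.mulVec w = Pi.single ν 1 := by
    rw [hw, Matrix.mulVec_mulVec, Matrix.mul_nonsing_inv M (isUnit_iff_ne_zero.2 hdet),
      Matrix.one_mulVec]
  have hsum : monomial ν.1 (1 : K) = ∑ ν', C (w ν') *
      (monomial (ν'.1 - Finsupp.single (sel ν') (e (sel ν'))) 1 * F (sel ν')) := by
    have hhom : (∑ ν', C (w ν') * (monomial (ν'.1 - Finsupp.single (sel ν') (e (sel ν'))) 1 *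
        F (sel ν'))).IsHomogeneous D := by
      refine IsHomogeneous.sum _ _ _ fun ν' _ ↦ IsHomogeneous.C_mul ?_ _
      have h1 : (ν'.1 - Finsupp.single (sel ν') (e (sel ν'))).degree + e (sel ν') = D := by
        conv_rhs => rw [← ν'.degree_eq,
          ← tsub_add_cancel_of_le (Finsupp.single_le_iff.2 (hsel ν')), map_add,
          Finsupp.degree_single]
      have := (isHomogeneous_monomial (1 : K) (rfl : _ =
        (ν'.1 - Finsupp.single (sel ν') (e (sel ν'))).degree)).mul (hF (sel ν'))
      rwa [h1] at this
    ext μ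
    by_cases hμ : μ.degree = D
    · have := congrFun hMw ⟨μ, mem_finsuppAntidiag_of_degree_eq hμ⟩
      rw [Matrix.mulVec, dotProduct] at this
      simp only [hM, macaulayMatrix, Matrix.of_apply] at this
      rw [coeff_sum]
      simp only [coeff_C_mul]
      rw [coeff_monomial, Finset.sum_congr rfl fun ν' _ ↦ mul_comm (w ν') _, this,
        Pi.single_apply]
      simp only [Subtype.ext_iff, eq_comm]
    · rw [hhom.coeff_eq_zero hμ,
        (isHomogeneous_monomial (1 : K) ν.degree_eq).coeff_eq_zero hμ]
  rw [hsum]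
  exact Ideal.sum_mem _ fun ν' _ ↦ Ideal.mul_mem_left _ _ (Ideal.mul_mem_left _ _
    (Ideal.subset_span ⟨_, rfl⟩))

theorem exists_le_of_sum_lt_degree (e : Fin r → ℕ) {μ : Fin r →₀ ℕ} (h : ∑ i, e i < μ.degree) :
    ∃ i, e i ≤ μ i := by
  by_contra! hlt
  rw [Finsupp.degree_eq_sum] at h
  exact h.not_ge (Finset.sum_le_sum fun i _ ↦ (hlt i).le)

end Macaulay

/-- The Macaulay determinant of forms with indeterminate coefficients is a nonzero polynomial.
Independence keeps it nonzero after substituting `genericCoeff f e`, so it is nonzero at some `x`.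
-/
theorem exists_monomial_mem_span_restriction {m r : ℕ} (f : Fin r → MvPolynomial (Fin m) ℂ)
    (e : Fin r → ℕ) (hf : ∀ i, (f i).IsHomogeneous (e i))
    (h : AlgebraicIndependent ℂ (genericCoeff f e)) :
    ∃ (x : Fin r × Fin m → ℂ) (D : ℕ), ∀ μ : Fin r →₀ ℕ, μ.degree = D →
      monomial μ (1 : ℂ) ∈ Ideal.span (Set.range fun i ↦ restriction x (f i)) := by
  classical
  -- Every monomial of this degree is divisible by some `t_i^{e_i}`. The `+ 1` is needed when `r =
  -- 0`, where the monomial `1` has no index to select.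
  set D := ∑ i, e i + 1
  have hex (ν : Exponent r D) : ∃ i, e i ≤ ν.1 i :=
    exists_le_of_sum_lt_degree e (by rw [ν.degree_eq]; exact Nat.lt_succ_self _)
  choose sel hsel using hex
  set G : Fin r → MvPolynomial (Fin r) (MvPolynomial (Σ i : Fin r, Exponent r (e i)) ℂ) :=
    fun i ↦ ∑ μ : Exponent r (e i), monomial μ.1 (X ⟨i, μ⟩) with hG
  have hP : (macaulayMatrix e sel G).det ≠ 0 := by
    intro h0
    -- The coefficients of `X i ^ e i`, for which the matrix is the identity.
    set y : (Σ i : Fin r, Exponent r (e i)) → ℂ :=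
      fun p ↦ if p.2.1 = Finsupp.single p.1 (e p.1) then 1 else 0 with hy
    have hGy (i : Fin r) : map (eval y) (G i) = X i ^ e i := by
      rw [hG, map_sum, X_pow_eq_monomial, Finset.sum_eq_single ⟨Finsupp.single i (e i),
        mem_finsuppAntidiag_of_degree_eq (Finsupp.degree_single _ _)⟩]
      · simp [hy]
      · intro μ _ hμ
        have : μ.1 ≠ Finsupp.single i (e i) := fun h ↦ hμ (Subtype.ext h)
        simp [hy, this]
      · simp
    have h1 := congrArg (eval y) h0
    rw [RingHom.map_det, RingHom.mapMatrix_apply, macaulayMatrix_map, funext hGy,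
      macaulayMatrix_X_pow e sel hsel] at h1
    simp at h1
  have hP' : aeval (genericCoeff f e) (macaulayMatrix e sel G).det ≠ 0 := fun h0 ↦
    hP (algebraicIndependent_iff.1 h _ h0)
  obtain ⟨x, hx⟩ : ∃ x, eval x (aeval (genericCoeff f e) (macaulayMatrix e sel G).det) ≠ 0 := by
    by_contra! hall
    exact hP' (MvPolynomial.funext fun x ↦ by rw [hall x, map_zero])
  have hGx (i : Fin r) : map ((eval x).comp (aeval (genericCoeff f e)).toRingHom) (G i) =
      restriction x (f i) := by
    rw [← map_genericRestriction, ← map_map]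
    congr 1
    ext1 μ
    simp only [hG, map_sum, map_monomial, AlgHom.toRingHom_eq_coe, RingHom.coe_coe, aeval_X,
      coeff_sum, coeff_monomial]
    by_cases hμ : μ.degree = e i
    · rw [Finset.sum_eq_single ⟨μ, mem_finsuppAntidiag_of_degree_eq hμ⟩]
      · simp [genericCoeff]
      · intro ν _ hν
        rw [if_neg fun h ↦ hν (Subtype.ext h)]
      · simp
    · rw [(isHomogeneous_genericRestriction (hf i)).coeff_eq_zero hμ]
      refine Finset.sum_eq_zero fun ν _ ↦ if_neg ?_
      rintro rfl
      exact hμ ν.degree_eq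
  refine ⟨x, D, fun μ hμ ↦ monomial_mem_span_of_macaulayMatrix_det_ne_zero e sel hsel
    (fun i ↦ isHomogeneous_restriction x (hf i)) ?_ ⟨μ, mem_finsuppAntidiag_of_degree_eq hμ⟩⟩
  convert hx using 1
  rw [← funext hGx, ← macaulayMatrix_map, ← RingHom.mapMatrix_apply, ← RingHom.map_det]
  rfl

/-! ### Finiteness over the subring generated by forms -/

section Nakayama

variable {σ J K : Type*} [Field K]

theorem monomial_mem_of_le_degree {I : Ideal (MvPolynomial σ K)} {D : ℕ}
    (hI : ∀ μ : σ →₀ ℕ, μ.degree = D → monomial μ (1 : K) ∈ I) {μ : σ →₀ ℕ} (hμ : D ≤ μ.degree) :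
    monomial μ (1 : K) ∈ I := by
  obtain ⟨n, hn⟩ : ∃ n, n = μ.degree := ⟨_, rfl⟩
  rw [← hn] at hμ
  induction n, hμ using Nat.le_induction generalizing μ with
  | base => exact hI μ hn.symm
  | succ n hle ih =>
    obtain ⟨i, hi⟩ : ∃ i, μ i ≠ 0 := by
      by_contra! h0
      have : μ = 0 := Finsupp.ext h0
      simp [this] at hn
    have hμ : μ = (μ - Finsupp.single i 1) + Finsupp.single i 1 :=
      (tsub_add_cancel_of_le (Finsupp.single_le_iff.2 (Nat.one_le_iff_ne_zero.2 hi))).symm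
    rw [hμ, map_add, Finsupp.degree_single] at hn
    have := I.mul_mem_right (monomial (Finsupp.single i 1) (1 : K))
      (ih (μ := μ - Finsupp.single i 1) (by omega))
    rwa [monomial_mul, one_mul, ← hμ] at this

/-- If forms of positive degree generate an ideal containing all monomials of some degree, then the
polynomial ring is finite over the subring they generate. -/
theorem finite_aeval_of_monomial_mem [Finite σ] [Fintype J] (p : J → MvPolynomial σ K) (d : J → ℕ)
    (hp : ∀ j, (p j).IsHomogeneous (d j)) (hd : ∀ j, 0 < d j) {D : ℕ}
    (hI : ∀ μ : σ →₀ ℕ, μ.degree = D → monomial μ (1 : K) ∈ Ideal.span (Set.range p)) :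
    (aeval p : MvPolynomial J K →ₐ[K] MvPolynomial σ K).toRingHom.Finite := by
  let := (aeval p : MvPolynomial J K →ₐ[K] MvPolynomial σ K).toRingHom.toAlgebra
  have smul_def (a : MvPolynomial J K) (q : MvPolynomial σ K) : a • q = aeval p a * q := rfl
  set T : Set (MvPolynomial σ K) := (fun μ ↦ monomial μ 1) '' {μ : σ →₀ ℕ | μ.degree ≤ D}
  set M := Submodule.span (MvPolynomial J K) T with hM
  have hC (a : K) {q : MvPolynomial σ K} (hq : q ∈ M) : C a * q ∈ M := by
    have := M.smul_mem (C a) hq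
    rwa [smul_def, algHom_C, algebraMap_eq] at this
  have hhom (n : ℕ) : ∀ q : MvPolynomial σ K, q.IsHomogeneous n → q ∈ M := by
    induction n using Nat.strong_induction_on with
    | _ n ih =>
      intro q hq
      rcases lt_or_ge n D with hn | hn
      · rw [q.as_sum]
        refine M.sum_mem fun μ hμ ↦ ?_
        rw [← mul_one (coeff μ q), ← C_mul_monomial]
        refine hC _ (Submodule.subset_span ⟨μ, ?_, rfl⟩)
        exact ((hq.degree_eq_sum_deg_support hμ).symm.trans_lt hn).le
      · have hqI : q ∈ Ideal.span (Set.range p) := by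
          rw [q.as_sum]
          refine Ideal.sum_mem _ fun μ hμ ↦ ?_
          rw [← mul_one (coeff μ q), ← C_mul_monomial]
          exact Ideal.mul_mem_left _ _ (monomial_mem_of_le_degree hI
            (hn.trans_eq (hq.degree_eq_sum_deg_support hμ)))
        obtain ⟨a, ha⟩ := Ideal.mem_span_range_iff_exists_fun.1 hqI
        -- Taking degree `n` parts replaces each `a j` by its component of degree `n - d j`, which
        -- is below `n` as `d j > 0`; induction applies.
        rw [← homogeneousComponent_eq_self hq, ← ha, map_sum]
        refine M.sum_mem fun j _ ↦ ?_
        rw [mul_comm, homogeneousComponent_mul_of_isHomogeneous_left (hp j)]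
        split_ifs with hj
        · have := M.smul_mem (X j) (ih (n - d j) (by have := hd j; omega) _
            (homogeneousComponent_isHomogeneous (n - d j) (a j)))
          rwa [smul_def, aeval_X] at this
        · exact M.zero_mem
  have htop : M = ⊤ := by
    refine eq_top_iff.2 fun q _ ↦ ?_
    rw [← sum_homogeneousComponent q]
    exact M.sum_mem fun n _ ↦ hhom n _ (homogeneousComponent_isHomogeneous n q)
  have hfin : T.Finite := (Finsupp.finite_of_degree_le D).image _
  exact ⟨⟨hfin.toFinset, by rw [hfin.coe_toFinset]; exact htop⟩⟩

end Nakayama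

/-! ### Dimension bounds for the zero locus -/

section Dimension

/-- By incomparability, contraction is strictly monotone on primes. -/
theorem ringKrullDim_le_of_isIntegral {R S : Type*} [CommRing R] [CommRing S] (φ : R →+* S)
    (hφ : φ.IsIntegral) : ringKrullDim S ≤ ringKrullDim R := by
  let := φ.toAlgebra
  have : Algebra.IsIntegral R S := ⟨hφ⟩
  refine Order.krullDim_le_of_strictMono (PrimeSpectrum.comap φ) fun P Q hPQ ↦ ?_
  exact Ideal.IsIntegral.comap_lt_comap (R := R) hPQ

theorem ringKrullDim_quotient_radical {R : Type*} [CommRing R] (I : Ideal R) :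
    ringKrullDim (R ⧸ I.radical) = ringKrullDim (R ⧸ I) := by
  rw [ringKrullDim_quotient, ringKrullDim_quotient, PrimeSpectrum.zeroLocus_radical]

variable {m : ℕ}

theorem ringKrullDim_mvPolynomial_complex (m : ℕ) :
    ringKrullDim (MvPolynomial (Fin m) ℂ) = m := by
  simp

/-- All points have the same local dimension. -/
theorem height_vanishingIdeal_singleton (x : Fin m → ℂ) :
    ((vanishingIdeal ℂ ({x} : Set (Fin m → ℂ))).height : WithBot ℕ∞) = m := by
  have : FiniteRingKrullDim (MvPolynomial (Fin m) ℂ) := by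
    refine Order.finiteDimensionalOrder_iff_krullDim_ne_bot_and_top.2 ⟨?_, ?_⟩ <;>
      rw [← ringKrullDim, ringKrullDim_mvPolynomial_complex]
    · exact WithBot.coe_ne_bot
    · exact fun h ↦ ENat.natCast_ne_top m (WithBot.coe_injective h)
  -- Some maximal ideal has height `m`; by the Nullstellensatz it is a point `y`, and a translation
  -- moves it to `x`.
  obtain ⟨P, hP, hPm⟩ := Ideal.exists_isMaximal_height (R := MvPolynomial (Fin m) ℂ)
  rw [ringKrullDim_mvPolynomial_complex] at hPm
  obtain ⟨y, rfl⟩ := isMaximal_iff_eq_vanishingIdeal_singleton.1 hP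
  rw [← hPm]
  have hinv (a b : Fin m → ℂ) (hab : a + b = 0) :
      (translateHom a).comp (translateHom b) = AlgHom.id ℂ (MvPolynomial (Fin m) ℂ) := by
    ext1 i
    have := congrFun hab i
    simp only [Pi.add_apply, Pi.zero_apply] at this
    simp [translateHom, add_assoc, ← C_add, this]
  let E : MvPolynomial (Fin m) ℂ ≃ₐ[ℂ] MvPolynomial (Fin m) ℂ :=
    AlgEquiv.ofAlgHom (translateHom (y - x)) (translateHom (x - y)) (hinv _ _ (by abel))
      (hinv _ _ (by abel))
  rw [← E.toRingEquiv.height_comap (vanishingIdeal ℂ ({x} : Set (Fin m → ℂ)))]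
  congr 2
  ext p
  have : aeval x (translateHom (y - x) p) = aeval y p := by
    rw [translateHom, ← AlgHom.comp_apply, comp_aeval]
    congr 2
    ext i
    simp
  simp only [Ideal.mem_comap, mem_vanishingIdeal_singleton_iff]
  rw [← this]
  rfl

theorem vanishingIdeal_commonZeros {r : ℕ} (f : Fin r → MvPolynomial (Fin m) ℂ) :
    vanishingIdeal ℂ (NuComplexity.commonZeros f) = (Ideal.span (Set.range f)).radical := by
  rw [← vanishingIdeal_zeroLocus_eq_radical (K := ℂ), zeroLocus_span]
  congr 1
  ext x
  simp [NuComplexity.commonZeros]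

theorem algDim_commonZeros {r : ℕ} (f : Fin r → MvPolynomial (Fin m) ℂ) :
    NuComplexity.algDim (NuComplexity.commonZeros f) =
      ringKrullDim (MvPolynomial (Fin m) ℂ ⧸ Ideal.span (Set.range f)) := by
  rw [NuComplexity.algDim, vanishingIdeal_commonZeros, ringKrullDim_quotient_radical]

/-- Krull's height theorem at the point `x`: each equation lowers the dimension by at most one. -/
theorem le_algDim_commonZeros_add {r : ℕ} (f : Fin r → MvPolynomial (Fin m) ℂ) {x : Fin m → ℂ}
    (hx : x ∈ NuComplexity.commonZeros f) :
    (m : WithBot ℕ∞) ≤ NuComplexity.algDim (NuComplexity.commonZeros f) + (r : WithBot ℕ∞) := by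
  rw [algDim_commonZeros, ← height_vanishingIdeal_singleton x]
  refine (Ideal.height_le_ringKrullDim_quotient_add_encard (Set.range f) ?_).trans ?_
  · rintro _ ⟨i, rfl⟩
    rw [SetLike.mem_coe, mem_vanishingIdeal_singleton_iff]
    exact hx i
  · gcongr
    have : (Set.range f).encard ≤ r := by
      rw [← Set.image_univ]
      exact (Set.encard_image_le _ _).trans (by simp)
    exact_mod_cast this

/-- The polynomial ring is finite over the subring generated by `f` and `l`. Modulo `f` only the `q`
elements `l` survive, so the quotient is integral over the image of a polynomial ring in `q`
variables. -/
theorem algDim_commonZeros_le {r q D : ℕ} (f : Fin r → MvPolynomial (Fin m) ℂ) (e : Fin r → ℕ)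
    (hf : ∀ i, (f i).IsHomogeneous (e i)) (he : ∀ i, 0 < e i) (l : Fin q → MvPolynomial (Fin m) ℂ)
    (hl : ∀ k, (l k).IsHomogeneous 1)
    (h : ∀ μ : Fin m →₀ ℕ, μ.degree = D →
      monomial μ (1 : ℂ) ∈ Ideal.span (Set.range (Sum.elim f l))) :
    NuComplexity.algDim (NuComplexity.commonZeros f) ≤ q := by
  rw [algDim_commonZeros, ← ringKrullDim_mvPolynomial_complex q]
  set I := Ideal.span (Set.range f)
  have hfin := (finite_aeval_of_monomial_mem (Sum.elim f l) (Sum.elim e fun _ ↦ 1)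
    (by rintro (i | k) <;> simp [hf, hl]) (by rintro (i | k) <;> simp [he]) h).to_isIntegral
  have hint : ((Ideal.Quotient.mkₐ ℂ I).comp (aeval (Sum.elim f l))).toRingHom.IsIntegral :=
    hfin.trans _ _ (RingHom.isIntegral_of_surjective _ Ideal.Quotient.mk_surjective)
  have hfac : (Ideal.Quotient.mkₐ ℂ I).comp (aeval (Sum.elim f l)) =
      ((Ideal.Quotient.mkₐ ℂ I).comp (aeval l)).comp (aeval (Sum.elim (fun _ ↦ 0) X)) := by
    ext1 (i | k)
    · have : Ideal.Quotient.mk I (f i) = 0 :=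
        Ideal.Quotient.eq_zero_iff_mem.2 (Ideal.subset_span ⟨i, rfl⟩)
      simp [this]
    · simp
  rw [hfac] at hint
  exact ringKrullDim_le_of_isIntegral ((Ideal.Quotient.mkₐ ℂ I).comp (aeval l)).toRingHom
    (RingHom.IsIntegral.tower_top _ _ hint)

end Dimension

/-! ### Slicing by linear forms -/

section Slice

variable {m r : ℕ}

/-- The linear form with coefficients `v`. -/
noncomputable def linearForm : (Fin m → ℂ) →ₗ[ℂ] MvPolynomial (Fin m) ℂ :=
  Fintype.linearCombination ℂ X

theorem linearForm_apply (v : Fin m → ℂ) : linearForm v = ∑ l, v l • X l := by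
  rw [linearForm, Fintype.linearCombination_apply]

theorem linearForm_single (l : Fin m) : linearForm (Pi.single l 1) = (X l : MvPolynomial _ ℂ) := by
  rw [linearForm_apply, Finset.sum_eq_single l]
  · simp
  · intro k _ hk
    simp [hk]
  · simp

theorem isHomogeneous_linearForm (v : Fin m → ℂ) : (linearForm v).IsHomogeneous 1 := by
  rw [linearForm_apply]
  refine IsHomogeneous.sum _ _ _ fun l _ ↦ ?_
  rw [smul_eq_C_mul]
  exact isHomogeneous_C_mul_X _ _

/-- The effect of `restriction x` on the coefficients of linear forms. -/
noncomputable def restrictionLinear (x : Fin r × Fin m → ℂ) : (Fin m → ℂ) →ₗ[ℂ] (Fin r → ℂ) :=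
  (Matrix.of fun j l ↦ x (j, l)).mulVecLin

theorem restrictionLinear_single (x : Fin r × Fin m → ℂ) (l : Fin m) :
    restrictionLinear x (Pi.single l 1) = fun j ↦ x (j, l) := by
  ext j
  simp [restrictionLinear]

theorem restriction_X (x : Fin r × Fin m → ℂ) (l : Fin m) :
    restriction x (X l) = linearForm fun j ↦ x (j, l) := by
  simp [restriction, linearForm_apply, smul_eq_C_mul]

theorem restriction_linearForm (x : Fin r × Fin m → ℂ) (v : Fin m → ℂ) :
    restriction x (linearForm v) = linearForm (restrictionLinear x v) := by
  have : (restriction x).toLinearMap ∘ₗ linearForm = linearForm ∘ₗ restrictionLinear x := by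
    refine LinearMap.pi_ext' fun l ↦ LinearMap.ext_ring ?_
    simp only [LinearMap.comp_apply, LinearMap.coe_single, AlgHom.toLinearMap_apply]
    rw [linearForm_single, restriction_X, restrictionLinear_single]
  exact LinearMap.congr_fun this v

/-- A functional `t` killing the image is a point of `ℂ^r` that the parametrisation sends to the
origin. All restricted forms vanish there, hence so does each `t_j^D`, and `t = 0`. -/
theorem restrictionLinear_surjective (f : Fin r → MvPolynomial (Fin m) ℂ) (e : Fin r → ℕ)
    (hf : ∀ i, (f i).IsHomogeneous (e i)) (he : ∀ i, 0 < e i) (x : Fin r × Fin m → ℂ) {D : ℕ}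
    (h : ∀ μ : Fin r →₀ ℕ, μ.degree = D →
      monomial μ (1 : ℂ) ∈ Ideal.span (Set.range fun i ↦ restriction x (f i))) :
    Function.Surjective (restrictionLinear x) := by
  rw [← LinearMap.range_eq_top]
  by_contra hne
  obtain ⟨φ, hφ0, hφ⟩ := Submodule.exists_le_ker_of_lt_top _ (lt_top_iff_ne_top.2 hne)
  set t : Fin r → ℂ := fun j ↦ φ (Pi.single j 1) with ht
  have hφt (v : Fin r → ℂ) : φ v = ∑ j, v j * t j := by
    rw [LinearMap.pi_apply_eq_sum_univ φ v]
    refine Finset.sum_congr rfl fun j _ ↦ ?_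
    rw [smul_eq_mul, ht]
    congr 2
    ext k
    simp [Pi.single_apply, eq_comm]
  have heval (p : MvPolynomial (Fin m) ℂ) : aeval t (restriction x p) = aeval (0 : Fin m → ℂ) p := by
    rw [← AlgHom.comp_apply]
    congr 1
    ext1 l
    have h0 : φ (restrictionLinear x (Pi.single l 1)) = 0 := hφ ⟨_, rfl⟩
    rw [hφt, restrictionLinear_single] at h0
    rw [AlgHom.comp_apply, restriction_X, linearForm_apply]
    simpa using h0
  have hle : Ideal.span (Set.range fun i ↦ restriction x (f i)) ≤ vanishingIdeal ℂ {t} := by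
    rw [Ideal.span_le]
    rintro _ ⟨i, rfl⟩
    rw [SetLike.mem_coe, mem_vanishingIdeal_singleton_iff, heval]
    have := (hf i).coeff_eq_zero (d := 0) (by simpa using (he i).ne)
    rw [← constantCoeff_eq] at this
    rw [← this]
    simp [constantCoeff]
  refine hφ0 (LinearMap.ext fun v ↦ ?_)
  rw [hφt, LinearMap.zero_apply]
  refine Finset.sum_eq_zero fun j _ ↦ ?_
  have := hle (h (Finsupp.single j D) (Finsupp.degree_single _ _))
  rw [mem_vanishingIdeal_singleton_iff, aeval_monomial] at this
  rw [eq_zero_of_pow_eq_zero (by simpa using this : t j ^ D = 0), mul_zero]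

/-- The kernel of a surjective restriction is generated by linear forms. -/
theorem mem_span_of_restriction_eq_zero {q : ℕ} {x : Fin r × Fin m → ℂ}
    (hx : Function.Surjective (restrictionLinear x))
    (b : Module.Basis (Fin q) ℂ (LinearMap.ker (restrictionLinear x))) {p : MvPolynomial (Fin m) ℂ}
    (hp : restriction x p = 0) :
    p ∈ Ideal.span (Set.range fun k ↦ linearForm (b k : Fin m → ℂ)) := by
  set I := Ideal.span (Set.range fun k ↦ linearForm (b k : Fin m → ℂ))
  have hker (v : Fin m → ℂ) (hv : restrictionLinear x v = 0) : linearForm v ∈ I := by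
    have := congrArg (fun w : LinearMap.ker (restrictionLinear x) ↦ linearForm (w : Fin m → ℂ))
      (b.sum_repr ⟨v, hv⟩)
    simp only [Submodule.coe_sum, Submodule.coe_smul, map_sum, map_smul] at this
    rw [← this]
    refine Ideal.sum_mem _ fun k _ ↦ ?_
    rw [smul_eq_C_mul]
    exact Ideal.mul_mem_left _ _ (Ideal.subset_span ⟨k, rfl⟩)
  -- A linear section induces an algebra map `τ`, and `τ` after `restriction x` is the identity
  -- modulo `I`.
  obtain ⟨s, hs⟩ := (restrictionLinear x).exists_rightInverse_of_surjective
    (LinearMap.range_eq_top.2 hx)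
  have hs' (w : Fin r → ℂ) : restrictionLinear x (s w) = w := LinearMap.congr_fun hs w
  set τ : MvPolynomial (Fin r) ℂ →ₐ[ℂ] MvPolynomial (Fin m) ℂ :=
    aeval fun j ↦ linearForm (s (Pi.single j 1)) with hτ
  have hτl (w : Fin r → ℂ) : τ (linearForm w) = linearForm (s w) := by
    have : (τ.toLinearMap ∘ₗ linearForm) = linearForm ∘ₗ s := by
      refine LinearMap.pi_ext' fun j ↦ LinearMap.ext_ring ?_
      simp only [LinearMap.comp_apply, LinearMap.coe_single, AlgHom.toLinearMap_apply]
      rw [linearForm_single, hτ, aeval_X]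
    exact LinearMap.congr_fun this w
  have hcomp : ((Ideal.Quotient.mkₐ ℂ I).comp τ).comp (restriction x) =
      Ideal.Quotient.mkₐ ℂ I := by
    ext1 l
    rw [AlgHom.comp_apply, AlgHom.comp_apply, ← linearForm_single, restriction_linearForm, hτl]
    refine Ideal.Quotient.eq.2 ?_
    rw [← map_sub]
    refine hker _ ?_
    rw [map_sub, hs', sub_self]
  have := AlgHom.congr_fun hcomp p
  rw [AlgHom.comp_apply, hp, map_zero] at this
  exact Ideal.Quotient.eq_zero_iff_mem.1 this.symm

/-- The kernel of the restriction is generated by `m - r` linear forms, so the monomial condition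
lifts to `f` together with these forms and bounds the dimension above. The origin is a common zero,
so Krull's bound gives the reverse inequality. -/
theorem isRegularSeq_of_monomial_mem_span_restriction (f : Fin r → MvPolynomial (Fin m) ℂ)
    (e : Fin r → ℕ) (hf : ∀ i, (f i).IsHomogeneous (e i)) (he : ∀ i, 0 < e i)
    (x : Fin r × Fin m → ℂ) {D : ℕ}
    (h : ∀ μ : Fin r →₀ ℕ, μ.degree = D →
      monomial μ (1 : ℂ) ∈ Ideal.span (Set.range fun i ↦ restriction x (f i))) :
    NuComplexity.IsRegularSeq f := by
  have hx := restrictionLinear_surjective f e hf he x h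
  have hq : r + Module.finrank ℂ (LinearMap.ker (restrictionLinear x)) = m := by
    have := LinearMap.finrank_range_add_finrank_ker (restrictionLinear x)
    rwa [LinearMap.range_eq_top.2 hx, finrank_top, Module.finrank_fin_fun,
      Module.finrank_fin_fun] at this
  set q := Module.finrank ℂ (LinearMap.ker (restrictionLinear x))
  let b : Module.Basis (Fin q) ℂ (LinearMap.ker (restrictionLinear x)) := Module.finBasis ℂ _
  have hsurj : Function.Surjective (restriction (κ := Fin r) x) := by
    have hX (j : Fin r) : (X j : MvPolynomial (Fin r) ℂ) ∈ (restriction x).range := by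
      obtain ⟨v, hv⟩ := hx (Pi.single j 1)
      exact ⟨linearForm v, by
        exact (restriction_linearForm x v).trans (by rw [hv, linearForm_single])⟩
    rw [← AlgHom.range_eq_top, eq_top_iff, ← adjoin_range_X, Algebra.adjoin_le_iff]
    rintro _ ⟨j, rfl⟩
    exact hX j
  have hle := algDim_commonZeros_le (D := D) f e hf he
    (fun k ↦ linearForm (b k : Fin m → ℂ)) (fun k ↦ isHomogeneous_linearForm _) fun μ hμ ↦ by
    have hmap : restriction x (monomial μ (1 : ℂ)) ∈
        (Ideal.span (Set.range f)).map (restriction x).toRingHom := by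
      rw [Ideal.map_span, ← Set.range_comp]
      have hhom := isHomogeneous_restriction x (isHomogeneous_monomial (1 : ℂ) hμ)
      rw [(restriction x (monomial μ (1 : ℂ))).as_sum]
      refine Ideal.sum_mem _ fun ν hν ↦ ?_
      rw [← mul_one (coeff ν _), ← C_mul_monomial]
      exact Ideal.mul_mem_left _ _ (h ν (hhom.degree_eq_sum_deg_support hν).symm)
    obtain ⟨G, hG, hGμ⟩ := (Ideal.mem_map_iff_of_surjective _ hsurj).1 hmap
    rw [Set.Sum.elim_range, Ideal.span_union, ← add_sub_cancel G (monomial μ (1 : ℂ))]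
    refine Submodule.add_mem_sup hG (mem_span_of_restriction_eq_zero hx b ?_)
    rw [map_sub, sub_eq_zero]
    exact hGμ.symm
  have h0 : (0 : Fin m → ℂ) ∈ NuComplexity.commonZeros f := fun i ↦ by
    have := (hf i).coeff_eq_zero (d := 0) (by simpa using (he i).ne)
    rw [← constantCoeff_eq] at this
    rw [← this]
    simp [constantCoeff]
  refine le_antisymm ?_ (le_algDim_commonZeros_add f h0)
  calc _ ≤ (q : WithBot ℕ∞) + (r : WithBot ℕ∞) := by gcongr
    _ = m := by rw [← hq]; push_cast; rw [add_comm]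

end Slice

/-! ### Constant forms, uniformity of the bound, and the conclusion -/

theorem isJointlyDecomposable_of_isHomogeneous_zero {m r : ℕ}
    (f : Fin r → MvPolynomial (Fin m) ℂ) {i : Fin r} (hi : (f i).IsHomogeneous 0) :
    NuComplexity.IsJointlyDecomposable 0 f := by
  classical
  have hsum : ∑ k, (Pi.single i 1 : Fin r → ℂ) k • f k = f i := by
    rw [Finset.sum_eq_single i] <;> simp +contextual
  refine ⟨Pi.single i 1, by simp, ?_, ?_⟩ <;> rw [hsum]
  · exact ⟨0, hi⟩
  · refine ⟨Fin.elim0, C (coeff 0 (f i)), fun j ↦ j.elim0, ?_⟩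
    rw [algHom_C, algebraMap_eq]
    exact totalDegree_eq_zero_iff_eq_C.1 (Nat.le_zero.1 hi.totalDegree_le)

theorem exists_bound_of_forall_le (d r : ℕ) (B : (Fin r → ℕ) → ℕ) :
    ∃ N, ∀ e : Fin r → ℕ, (∀ i, e i ≤ d) → B e ≤ N :=
  ⟨Finset.univ.sup fun e : Fin r → Fin (d + 1) ↦ B fun i ↦ e i, fun e he ↦
    Finset.le_sup (f := fun e : Fin r → Fin (d + 1) ↦ B fun i ↦ e i)
      (Finset.mem_univ fun i ↦ (⟨e i, Nat.lt_succ_of_le (he i)⟩ : Fin (d + 1)))⟩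

theorem mainTheorem2 (d r : ℕ) :
    ∃ N : ℕ, ∀ (m : ℕ) (f : Fin r → MvPolynomial (Fin m) ℂ),
      (∀ i, ∃ e : ℕ, e ≤ d ∧ (f i).IsHomogeneous e) →
      (N : ℕ∞) < NuComplexity.nu f →
      NuComplexity.IsRegularSeq f := by
  -- The bound depends only on the degree tuple, of which there are finitely many.
  obtain ⟨N, hNe⟩ := exists_bound_of_forall_le d r fun e ↦
    Fintype.card (Σ i : Fin r, Exponent r (e i)) * d
  refine ⟨N, fun m f hf hN ↦ ?_⟩
  choose e hed hf using hf
  have hnot (n : ℕ) (hn : n ≤ N) : ¬ NuComplexity.IsJointlyDecomposable n f := fun h ↦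
    ((iInf₂_le n h).trans (Nat.cast_le.2 hn)).not_gt hN
  have he (i : Fin r) : 0 < e i := Nat.pos_of_ne_zero fun h0 ↦
    hnot 0 (Nat.zero_le _) (isJointlyDecomposable_of_isHomogeneous_zero f (h0 ▸ hf i))
  have hind : AlgebraicIndependent ℂ (genericCoeff f e) := by
    by_contra hdep
    obtain ⟨i, n, hn, hdec⟩ := exists_isJointlyDecomposable f e hf he hdep
    exact hnot n (hn.trans ((Nat.mul_le_mul_left _ (hed i)).trans (hNe e hed))) hdec
  obtain ⟨x, D, hD⟩ := exists_monomial_mem_span_restriction f e hf hind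
  exact isRegularSeq_of_monomial_mem_span_restriction f e hf he x hD
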